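/- Let $0<\lambda<1$ and let $T_\lambda$ be the thinning map on complex sequences $x=(x_k)_{k\in\mathbb N}$ (with $0\in\mathbb N$), $$[T_\lambda(x)]_n=\sum_{k=n}^\infty\binom kn\lambda^n(1-\lambda)^{k-n}x_k,\qquad n\in\mathbb N .$$ For $p\ge1$ let $\|x\|_p=\big(\sum_{n}|x_n|^p\big)^{1/p}\in[0,\infty]$, and let $$\|T_\lambda\|_{p\to q}=\sup_{0<\|x\|_p<\infty}\frac{\|T_\lambda(x)\|_q}{\|x\|_p}\in[0,\infty].$$ For $0<z<1$ let $\omega(z)$ be the geometric distribution $\omega_n(z)=(1-z)z^n$, $n\in\mathbb N$. All exponents $p,q$ are finite real numbers. 1. If $1<p<q$, then $\|T_\lambda\|_{p\to q}<\infty$, and there is $z\in(0,1)$, depending on $\lambda,p,q$, such that for every nonzero complex sequence $x$ with $\|x\|_p<\infty$ $$\frac{\|T_\lambda(x)\|_q}{\|x\|_p}\le\frac{\|T_\lambda(\omega(z))\|_q}{\|\omega(z)\|_p}=\|T_\lambda\|_{p\to q}.$$ 2. If $p>1$, then for every nonzero complex sequence $x$ with $\|x\|_p<\infty$ $$\frac{\|T_\lambda(x)\|_p}{\|x\|_p}\le\lim_{z\to1^-}\frac{\|T_\lambda(\omega(z))\|_p}{\|\omega(z)\|_p}=\lambda^{\frac{1-p}{p}}=\|T_\lambda\|_{p\to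 p}.$$ 3. If $1<q<p$, then $$\lim_{z\to1^-}\frac{\|T_\lambda(\omega(z))\|_q}{\|\omega(z)\|_p}=\infty=\|T_\lambda\|_{p\to q}.$$ -/

import Mathlib

open scoped ENNReal Topology

namespace Thinning

noncomputable section

/-- The transition probability `r_{n|k} = (k choose n) l^n (1 - l)^(k - n)`: the probability that
`n` out of `k` incoming particles are transmitted, each independently with probability `l`.
It vanishes for `k < n`, since then `k.choose n = 0`. -/
def transition (l : ℝ) (n k : ℕ) : ℝ :=
  (k.choose n : ℝ) * l ^ n * (1 - l) ^ (k - n)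

/-- The thinning map on complex sequences, `[T x]_n = ∑_k r_{n|k} x_k`. -/
def thinning (l : ℝ) (x : ℕ → ℂ) : ℕ → ℂ :=
  fun n => ∑' k, (transition l n k : ℂ) * x k

/-- The `l^p` norm `(∑_n |x_n|^p)^(1/p)` of a complex sequence, with values in `[0, ∞]`. -/
def seqNorm (p : ℝ) (x : ℕ → ℂ) : ℝ≥0∞ :=
  (∑' n, ‖x n‖ₑ ^ p) ^ (1 / p)

/-- The `l^p → l^q` norm of a map on complex sequences: the supremum in `[0, ∞]` of
`‖T x‖_q / ‖x‖_p` over all sequences with `0 < ‖x‖_p < ∞`. -/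
def opNorm (p q : ℝ) (T : (ℕ → ℂ) → (ℕ → ℂ)) : ℝ≥0∞ :=
  ⨆ (x : ℕ → ℂ) (_ : 0 < seqNorm p x) (_ : seqNorm p x < ∞), seqNorm q (T x) / seqNorm p x

/-- The geometric probability distribution `ω_n(z) = (1 - z) z^n`, as a complex sequence. -/
def geom (z : ℝ) : ℕ → ℂ :=
  fun n => (((1 - z) * z ^ n : ℝ) : ℂ)

/-- The `l^p` norm is Mathlib's `L^p` seminorm for the counting measure. -/
theorem seqNorm_eq_eLpNorm {p : ℝ} (hp : 0 < p) (x : ℕ → ℂ) :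
    seqNorm p x = MeasureTheory.eLpNorm x (ENNReal.ofReal p) MeasureTheory.Measure.count := by
  rw [MeasureTheory.eLpNorm_eq_lintegral_rpow_enorm_toReal (by simpa using hp) (by simp),
    MeasureTheory.lintegral_count, ENNReal.toReal_ofReal hp.le, seqNorm]

/-- The series that defines the thinning converges absolutely on every `l^p`. -/
theorem summable_thinning {l p : ℝ} (hl0 : 0 < l) (hl1 : l < 1) (hp : 0 < p) {x : ℕ → ℂ}
    (hx : seqNorm p x < ∞) (n : ℕ) : Summable fun k => (transition l n k : ℂ) * x k := by
  have hS : (∑' n, ‖x n‖ₑ ^ p) ≠ ∞ := by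
    intro h
    rw [seqNorm, h, ENNReal.top_rpow_of_pos (by positivity)] at hx
    exact lt_irrefl _ hx
  have hb : ∀ k, ‖x k‖ ≤ (seqNorm p x).toReal := by
    intro k
    have h1 : ‖x k‖ₑ ≤ seqNorm p x := by
      rw [seqNorm, one_div, ENNReal.le_rpow_inv_iff hp]
      exact ENNReal.le_tsum k
    have h2 := ENNReal.toReal_mono hx.ne h1
    simpa using h2
  have hr : Summable fun k => transition l n k := by
    rw [← summable_nat_add_iff n]
    have h := summable_choose_mul_geometric_of_norm_lt_one n
      (r := 1 - l) (by rw [Real.norm_eq_abs, abs_lt]; constructor <;> linarith)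
    refine (h.mul_left (l ^ n)).congr fun k => ?_
    simp only [transition, Nat.add_sub_cancel]
    ring
  have hr0 : ∀ k, 0 ≤ transition l n k := fun k => by
    have : 0 ≤ 1 - l := by linarith
    unfold transition
    positivity
  refine Summable.of_norm_bounded (hr.mul_right (seqNorm p x).toReal) fun k => ?_
  rw [norm_mul, Complex.norm_real, Real.norm_of_nonneg (hr0 k)]
  exact mul_le_mul_of_nonneg_left (hb k) (hr0 k)

end

end Thinning

namespace Thinning

/-! Let `S` be the left shift and `w = T (S x)`. Pascal's rule gives `T x = (x 0, l w) + (1 - l) w`,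
where `(x 0, l w)` is `x 0` followed by the sequence `l w`. The triangle inequality then bounds `‖T
x‖_q` by `(|x 0|^q + l^q ‖w‖_q^q)^(1/q) + (1 - l) ‖w‖_q`. If `‖w‖_q ≤ C ‖S x‖_p` is known and `z =
‖S x‖_p / ‖x‖_p`, the bound `‖T x‖_q ≤ C ‖x‖_p` follows as soon as `C^q ≥ ratioPow l p q z`.
Induction on the support, then Fatou, give it for all of `ℓ^p` (`seqNorm_thinning_le`).

Thinning maps geometric sequences to geometric ones, and `ratioPow l p q z` is exactly the `q`-th
power of the norm ratio at `ω(z)`. So geometric distributions realise the supremum, and only a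
function of `z ∈ (0,1)` is left. Near `z = 1` it behaves like a constant times `(1 - z^p)^(q/p -
1)`. Hence it tends to `0` for `p < q` (an interior maximum exists), to `l^(1-p)` for `p = q` (also
an upper bound, by convexity), and to `∞` for `q < p`. -/

/-! ### Recursion of the thinning under the shift -/

theorem transition_zero_succ (l : ℝ) (k : ℕ) :
    transition l 0 (k + 1) = (1 - l) * transition l 0 k := by
  simp [transition, pow_succ, mul_comm]

theorem transition_succ_succ (l : ℝ) (n k : ℕ) :
    transition l (n + 1) (k + 1) = l * transition l n k + (1 - l) * transition l (n + 1) k := by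
  simp only [transition, Nat.choose_succ_succ, Nat.cast_add, Nat.add_sub_add_right]
  rcases lt_or_ge n k with h | h
  · obtain ⟨d, rfl⟩ := Nat.exists_eq_add_of_lt h
    rw [show n + d + 1 - n = d + 1 by omega, show n + d + 1 - (n + 1) = d by omega]
    ring
  · rw [Nat.choose_eq_zero_of_lt (show k < n + 1 by omega)]
    push_cast
    ring

theorem seqNorm_rpow {p : ℝ} (hp : 0 < p) (x : ℕ → ℂ) :
    seqNorm p x ^ p = ∑' n, ‖x n‖ₑ ^ p := by
  rw [seqNorm, one_div, ENNReal.rpow_inv_rpow hp.ne']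

theorem seqNorm_zero_add {p : ℝ} (hp : 0 < p) (x : ℕ → ℂ) :
    seqNorm p x = (‖x 0‖ₑ ^ p + seqNorm p (fun n => x (n + 1)) ^ p) ^ (1 / p) := by
  rw [seqNorm_rpow hp, seqNorm, tsum_eq_zero_add' ENNReal.summable]

theorem seqNorm_mono {p : ℝ} (hp : 0 < p) {x y : ℕ → ℂ} (h : ∀ n, ‖x n‖ₑ ≤ ‖y n‖ₑ) :
    seqNorm p x ≤ seqNorm p y := by
  refine ENNReal.rpow_le_rpow (ENNReal.tsum_le_tsum fun n => ?_) (by positivity)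
  exact ENNReal.rpow_le_rpow (h n) hp.le

theorem seqNorm_lt_top_of_support {p : ℝ} (hp : 0 < p) {x : ℕ → ℂ} {N : ℕ}
    (hx : ∀ k, N ≤ k → x k = 0) : seqNorm p x < ∞ := by
  refine ENNReal.rpow_lt_top_of_nonneg (by positivity) ?_
  rw [tsum_eq_sum (s := Finset.range N)]
  · exact (ENNReal.sum_lt_top.2 fun k _ =>
      ENNReal.rpow_lt_top_of_nonneg hp.le enorm_ne_top).ne
  · intro k hk
    simp [hx k (by simpa using hk), hp]

theorem seqNorm_add_le {q : ℝ} (hq : 1 ≤ q) (x y : ℕ → ℂ) :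
    seqNorm q (fun n => x n + y n) ≤ seqNorm q x + seqNorm q y := by
  have hq0 : 0 < q := by linarith
  simp only [seqNorm_eq_eLpNorm hq0]
  exact MeasureTheory.eLpNorm_add_le .of_discrete .of_discrete (by simpa using hq)

theorem seqNorm_const_mul {q : ℝ} (hq : 0 < q) (c : ℂ) (x : ℕ → ℂ) :
    seqNorm q (fun n => c * x n) = ‖c‖ₑ * seqNorm q x := by
  simp only [seqNorm_eq_eLpNorm hq]
  exact MeasureTheory.eLpNorm_const_smul c x _ _

theorem thinning_zero {l p : ℝ} (hl0 : 0 < l) (hl1 : l < 1) (hp : 0 < p) {x : ℕ → ℂ}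
    (hx : seqNorm p x < ∞) :
    thinning l x 0 = x 0 + (1 - l : ℝ) * thinning l (fun n => x (n + 1)) 0 := by
  simp only [thinning]
  rw [(summable_thinning hl0 hl1 hp hx 0).tsum_eq_zero_add, ← tsum_mul_left]
  congr 1
  · simp [transition]
  · refine tsum_congr fun k => ?_
    rw [transition_zero_succ]
    push_cast
    ring

theorem seqNorm_shift_lt_top {p : ℝ} (hp : 0 < p) {x : ℕ → ℂ} (hx : seqNorm p x < ∞) :
    seqNorm p (fun n => x (n + 1)) < ∞ := by
  refine lt_of_le_of_lt ?_ hx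
  rw [seqNorm_zero_add hp x, one_div, ENNReal.le_rpow_inv_iff hp]
  exact le_add_self

theorem thinning_succ {l p : ℝ} (hl0 : 0 < l) (hl1 : l < 1) (hp : 0 < p) {x : ℕ → ℂ}
    (hx : seqNorm p x < ∞) (n : ℕ) :
    thinning l x (n + 1) = (l : ℂ) * thinning l (fun n => x (n + 1)) n
      + (1 - l : ℝ) * thinning l (fun n => x (n + 1)) (n + 1) := by
  have hs := summable_thinning hl0 hl1 hp (seqNorm_shift_lt_top hp hx)
  simp only [thinning]
  rw [(summable_thinning hl0 hl1 hp hx (n + 1)).tsum_eq_zero_add, ← tsum_mul_left,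
    ← tsum_mul_left, ← ((hs n).mul_left _).tsum_add ((hs (n + 1)).mul_left _)]
  have h0 : (transition l (n + 1) 0 : ℂ) * x 0 = 0 := by simp [transition]
  rw [h0, zero_add]
  refine tsum_congr fun k => ?_
  rw [transition_succ_succ]
  push_cast
  ring

/-- One step of the recursion for thinning, from the triangle inequality in `ℓ^q`. -/
theorem seqNorm_thinning_le_step {l p q : ℝ} (hl0 : 0 < l) (hl1 : l < 1) (hp : 0 < p)
    (hq : 1 ≤ q) {x : ℕ → ℂ} (hx : seqNorm p x < ∞) :
    seqNorm q (thinning l x) ≤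
      (‖x 0‖ₑ ^ q + (ENNReal.ofReal l * seqNorm q (thinning l fun n => x (n + 1))) ^ q) ^ (1 / q)
        + ENNReal.ofReal (1 - l) * seqNorm q (thinning l fun n => x (n + 1)) := by
  have hq0 : 0 < q := by linarith
  set w := thinning l fun n => x (n + 1) with hw
  -- `x 0` and `l w` occupy disjoint coordinates of `y`, so its norm is computed exactly; only the
  -- sum with `(1 - l) w` costs an inequality.
  let y : ℕ → ℂ := fun n => Nat.casesOn n (x 0) fun m => (l : ℂ) * w m
  have hT : thinning l x = fun n => y n + (1 - l : ℝ) * w n := by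
    funext n
    cases n with
    | zero => exact thinning_zero hl0 hl1 hp hx
    | succ n => exact thinning_succ hl0 hl1 hp hx n
  have he : ∀ r : ℝ, 0 ≤ r → ‖(r : ℂ)‖ₑ = ENNReal.ofReal r := fun r hr => by
    rw [← ofReal_norm, Complex.norm_real, Real.norm_of_nonneg hr]
  rw [hT]
  refine (seqNorm_add_le hq _ _).trans (add_le_add (le_of_eq ?_) (le_of_eq ?_))
  · rw [seqNorm_zero_add hq0 y, ← he l hl0.le, ← seqNorm_const_mul hq0 (l : ℂ) w]
    rfl
  · rw [seqNorm_const_mul hq0, he _ (by linarith)]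

/-! ### Upper bound from a scalar inequality -/

/-- The claim is homogeneous in `(a, b)`, so it reduces to `h` at `z = b / s`, where `1 - z ^ p = (a
/ s) ^ p`. In the application `a` is `|x 0|` and `b` is the norm of the shifted sequence. -/
theorem rpow_add_rpow_bound {l p q C : ℝ} (hl0 : 0 ≤ l) (hp : 0 < p)
    (hq : 0 < q) (hC : 0 ≤ C)
    (h : ∀ z : ℝ, 0 ≤ z → z ≤ 1 →
      (1 - z ^ p) ^ (q / p) + (l * C * z) ^ q ≤ (C * (1 - (1 - l) * z)) ^ q)
    {a b : ℝ} (ha : 0 ≤ a) (hb : 0 ≤ b) :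
    (a ^ q + (l * (C * b)) ^ q) ^ (1 / q) + (1 - l) * (C * b) ≤ C * (a ^ p + b ^ p) ^ (1 / p) := by
  have hS : 0 ≤ a ^ p + b ^ p := by positivity
  set s := (a ^ p + b ^ p) ^ (1 / p) with hs
  have hs0 : 0 ≤ s := by positivity
  have hsp : s ^ p = a ^ p + b ^ p := by rw [hs, one_div, Real.rpow_inv_rpow hS hp.ne']
  have hbs : b ≤ s := by
    rw [← Real.rpow_le_rpow_iff hb hs0 hp, hsp]
    linarith [Real.rpow_nonneg ha p]
  rcases hs0.eq_or_lt with h0 | hs0'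
  · rw [← h0, Real.zero_rpow hp.ne'] at hsp
    have hb0 : b = 0 := le_antisymm (h0 ▸ hbs) hb
    have ha0 : a = 0 := by
      rw [hb0, Real.zero_rpow hp.ne', add_zero] at hsp
      exact (Real.rpow_eq_zero ha hp.ne').1 hsp.symm
    simp [ha0, hb0, ← h0, hq.ne']
  have hz0 : 0 ≤ b / s := by positivity
  have hz1 : b / s ≤ 1 := (div_le_one hs0').2 hbs
  have hy : 0 ≤ 1 - (1 - l) * (b / s) := by nlinarith
  have hz := mul_le_mul_of_nonneg_right (h (b / s) hz0 hz1) (Real.rpow_nonneg hs0 q)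
  have h1 : (1 - (b / s) ^ p) ^ (q / p) * s ^ q = a ^ q := by
    have e : 1 - (b / s) ^ p = (a / s) ^ p := by
      rw [Real.div_rpow hb hs0, Real.div_rpow ha hs0]
      have : s ^ p ≠ 0 := (Real.rpow_pos_of_pos hs0' p).ne'
      field_simp
      linarith
    rw [e, ← Real.rpow_mul (by positivity), mul_div_cancel₀ _ hp.ne',
      ← Real.mul_rpow (by positivity) hs0, div_mul_cancel₀ _ hs0'.ne']
  have h2 : (l * C * (b / s)) ^ q * s ^ q = (l * (C * b)) ^ q := by
    rw [← Real.mul_rpow (by positivity) hs0]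
    congr 1
    field_simp
  have h3 : (C * (1 - (1 - l) * (b / s))) ^ q * s ^ q = (C * s - (1 - l) * (C * b)) ^ q := by
    rw [← Real.mul_rpow (by positivity) hs0]
    congr 1
    field_simp
  rw [add_mul, h1, h2, h3] at hz
  have h4 : 0 ≤ C * s - (1 - l) * (C * b) := by
    have : (1 - l) * (C * b) ≤ 1 * (C * s) := by gcongr; linarith
    linarith
  have h5 := Real.rpow_le_rpow (by positivity) hz (show 0 ≤ 1 / q by positivity)
  rw [one_div, Real.rpow_rpow_inv h4 hq.ne'] at h5
  rw [one_div]
  linarith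

theorem enn_rpow_add_rpow_bound {l p q C : ℝ} (hl0 : 0 ≤ l) (hl1 : l ≤ 1) (hp : 0 < p)
    (hq : 0 < q) (hC : 0 ≤ C)
    (h : ∀ z : ℝ, 0 ≤ z → z ≤ 1 →
      (1 - z ^ p) ^ (q / p) + (l * C * z) ^ q ≤ (C * (1 - (1 - l) * z)) ^ q)
    {A B : ℝ≥0∞} (hA : A ≠ ∞) (hB : B ≠ ∞) :
    (A ^ q + (ENNReal.ofReal l * (ENNReal.ofReal C * B)) ^ q) ^ (1 / q)
      + ENNReal.ofReal (1 - l) * (ENNReal.ofReal C * B)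
      ≤ ENNReal.ofReal C * (A ^ p + B ^ p) ^ (1 / p) := by
  have hl : 0 ≤ 1 - l := by linarith
  obtain ⟨a, ha, rfl⟩ : ∃ a : ℝ, 0 ≤ a ∧ A = ENNReal.ofReal a :=
    ⟨A.toReal, by simp, (ENNReal.ofReal_toReal hA).symm⟩
  obtain ⟨b, hb, rfl⟩ : ∃ a : ℝ, 0 ≤ a ∧ B = ENNReal.ofReal a :=
    ⟨B.toReal, by simp, (ENNReal.ofReal_toReal hB).symm⟩
  have := ENNReal.ofReal_le_ofReal (rpow_add_rpow_bound hl0 hp hq hC h ha hb)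
  rw [ENNReal.ofReal_add (by positivity) (by positivity), ENNReal.ofReal_mul hl,
    ENNReal.ofReal_mul hC, ENNReal.ofReal_mul hC,
    ← ENNReal.ofReal_rpow_of_nonneg (by positivity) (by positivity),
    ← ENNReal.ofReal_rpow_of_nonneg (by positivity) (by positivity),
    ENNReal.ofReal_add (by positivity) (by positivity),
    ENNReal.ofReal_add (by positivity) (by positivity),
    ← ENNReal.ofReal_rpow_of_nonneg ha hp.le, ← ENNReal.ofReal_rpow_of_nonneg hb hp.le,
    ← ENNReal.ofReal_rpow_of_nonneg ha hq.le,
    ← ENNReal.ofReal_rpow_of_nonneg (by positivity) hq.le, ENNReal.ofReal_mul hl0,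
    ENNReal.ofReal_mul hC] at this
  exact this

theorem seqNorm_thinning_le_of_support {l p q C : ℝ} (hl0 : 0 < l) (hl1 : l < 1) (hp : 0 < p)
    (hq : 1 ≤ q) (hC : 0 ≤ C)
    (h : ∀ z : ℝ, 0 ≤ z → z ≤ 1 →
      (1 - z ^ p) ^ (q / p) + (l * C * z) ^ q ≤ (C * (1 - (1 - l) * z)) ^ q)
    (N : ℕ) : ∀ x : ℕ → ℂ, (∀ k, N ≤ k → x k = 0) →
      seqNorm q (thinning l x) ≤ ENNReal.ofReal C * seqNorm p x := by
  have hq0 : 0 < q := by linarith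
  induction N with
  | zero =>
    intro x hx
    have : x = fun _ => 0 := funext fun k => hx k (Nat.zero_le k)
    subst this
    simp [seqNorm, thinning, hq0]
  | succ N ih =>
    intro x hx
    have hw := ih (fun n => x (n + 1)) fun k hk => hx (k + 1) (by omega)
    have hx' := seqNorm_lt_top_of_support hp hx
    rw [seqNorm_zero_add hp x]
    refine (seqNorm_thinning_le_step hl0 hl1 hp hq hx').trans (le_trans ?_
      (enn_rpow_add_rpow_bound hl0.le hl1.le hp hq0 hC h (by simp)
        (seqNorm_shift_lt_top hp hx').ne))
    gcongr

/-- The norm of the thinning is bounded by every `C` that satisfies a scalar inequality. -/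
theorem seqNorm_thinning_le {l p q C : ℝ} (hl0 : 0 < l) (hl1 : l < 1) (hp : 0 < p)
    (hq : 1 ≤ q) (hC : 0 ≤ C)
    (h : ∀ z : ℝ, 0 ≤ z → z ≤ 1 →
      (1 - z ^ p) ^ (q / p) + (l * C * z) ^ q ≤ (C * (1 - (1 - l) * z)) ^ q)
    {x : ℕ → ℂ} (hx : seqNorm p x < ∞) :
    seqNorm q (thinning l x) ≤ ENNReal.ofReal C * seqNorm p x := by
  have hq0 : 0 < q := by linarith
  -- The thinnings of the truncations converge pointwise, and Fatou's lemma carries the uniform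
  -- bound to the limit.
  let y : ℕ → ℕ → ℂ := fun N k => if k < N then x k else 0
  have hy : ∀ N, seqNorm q (thinning l (y N)) ≤ ENNReal.ofReal C * seqNorm p x := fun N => by
    refine (seqNorm_thinning_le_of_support hl0 hl1 hp hq hC h N (y N) fun k hk => ?_).trans ?_
    · simp [y, hk]
    · gcongr
      refine seqNorm_mono hp fun n => ?_
      by_cases hn : n < N <;> simp [y, hn]
  have hlim : ∀ n, Filter.Tendsto (fun N => thinning l (y N) n) Filter.atTop
      (𝓝 (thinning l x n)) := fun n => by
    refine (summable_thinning hl0 hl1 hp hx n).hasSum.tendsto_sum_nat.congr fun N => ?_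
    rw [thinning, tsum_eq_sum (s := Finset.range N)]
    · refine Finset.sum_congr rfl fun k hk => ?_
      simp [y, Finset.mem_range.1 hk]
    · intro k hk
      simp [y, show ¬ k < N by simpa using hk]
  simp only [seqNorm_eq_eLpNorm hq0] at hy ⊢
  refine (MeasureTheory.Lp.eLpNorm_lim_le_liminf_eLpNorm (fun N => .of_discrete) _
    (Filter.Eventually.of_forall hlim)).trans ?_
  exact (Filter.liminf_le_liminf (Filter.Eventually.of_forall hy)).trans (by simp)

/-! ### The norm ratio as a function of `z` -/

/-- The denominator of the `q`-th power of the norm ratio at a geometric distribution. -/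
noncomputable def ratioDenom (l q z : ℝ) : ℝ := (1 - (1 - l) * z) ^ q - (l * z) ^ q

/-- The `q`-th power of the `ℓ^p → ℓ^q` norm ratio at the geometric distribution. -/
noncomputable def ratioPow (l p q z : ℝ) : ℝ := (1 - z ^ p) ^ (q / p) / ratioDenom l q z

theorem ratioDenom_lower {l q z : ℝ} (hl0 : 0 < l) (hl1 : l < 1) (hq : 1 ≤ q) (hz0 : 0 ≤ z)
    (hz1 : z ≤ 1) : l ^ (q - 1) * (1 - z ^ q) ≤ ratioDenom l q z := by
  have hy : 0 ≤ 1 - (1 - l) * z := by nlinarith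
  -- The second point is chosen so that the convex combination with weights `1 - l` and `l` equals
  -- `1`.
  have h := (convexOn_rpow hq).2 (x := z) (y := (1 - (1 - l) * z) / l) hz0
    (div_nonneg hy hl0.le) (show 0 ≤ 1 - l by linarith) hl0.le (by ring)
  simp only [smul_eq_mul] at h
  rw [mul_div_cancel₀ _ hl0.ne', Real.div_rpow hy hl0.le,
    show (1 - l) * z + (1 - (1 - l) * z) = 1 by ring, Real.one_rpow] at h
  have hlq : 0 < l ^ (q - 1) := Real.rpow_pos_of_pos hl0 _
  have e : l ^ q = l ^ (q - 1) * l := by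
    rw [← Real.rpow_add_one hl0.ne', sub_add_cancel]
  rw [ratioDenom, Real.mul_rpow hl0.le hz0]
  rw [e] at h ⊢
  have h2 := mul_le_mul_of_nonneg_left h hlq.le
  have h3 : l ^ (q - 1) * ((1 - l) * z ^ q + l * ((1 - (1 - l) * z) ^ q / (l ^ (q - 1) * l)))
      = l ^ (q - 1) * (1 - l) * z ^ q + (1 - (1 - l) * z) ^ q := by
    field_simp
  rw [h3] at h2
  linarith

theorem ratioDenom_pos {l q z : ℝ} (hl0 : 0 < l) (hl1 : l < 1) (hq : 1 ≤ q) (hz0 : 0 ≤ z)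
    (hz1 : z < 1) : 0 < ratioDenom l q z := by
  refine lt_of_lt_of_le ?_ (ratioDenom_lower hl0 hl1 hq hz0 hz1.le)
  have : z ^ q < 1 := Real.rpow_lt_one hz0 hz1 (by linarith)
  exact mul_pos (Real.rpow_pos_of_pos hl0 _) (by linarith)

theorem hasDerivAt_ratioDenom_one {l : ℝ} (q : ℝ) (hl0 : 0 < l) :
    HasDerivAt (ratioDenom l q) (-(q * l ^ (q - 1))) 1 := by
  have h1 : HasDerivAt (fun z : ℝ => 1 - (1 - l) * z) (-((1 - l) * 1)) 1 :=
    ((hasDerivAt_id (1 : ℝ)).const_mul (1 - l)).const_sub 1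
  have h2 : HasDerivAt (fun z : ℝ => l * z) (l * 1) 1 := (hasDerivAt_id (1 : ℝ)).const_mul l
  have h : HasDerivAt (ratioDenom l q) _ 1 := (h1.rpow_const (p := q) (Or.inl (by linarith))).sub
    (h2.rpow_const (p := q) (Or.inl (by linarith)))
  refine h.congr_deriv ?_
  rw [show 1 - (1 - l) * 1 = l by ring, mul_one l]
  ring

/-- L'Hôpital's rule: both functions vanish at `1`, so the quotient is a quotient of slopes. -/
theorem tendsto_one_sub_rpow_div_ratioDenom {l : ℝ} (p : ℝ) {q : ℝ} (hl0 : 0 < l)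
    (hq : 0 < q) :
    Filter.Tendsto (fun z => (1 - z ^ p) / ratioDenom l q z) (𝓝[<] 1)
      (𝓝 (p / (q * l ^ (q - 1)))) := by
  have h1 : HasDerivAt (fun z : ℝ => 1 - z ^ p) (-p) 1 := by
    simpa using (Real.hasDerivAt_rpow_const (x := 1) (p := p) (Or.inl one_ne_zero)).const_sub 1
  have h2 := hasDerivAt_ratioDenom_one q hl0
  have hne : -(q * l ^ (q - 1)) ≠ 0 := by
    have := Real.rpow_pos_of_pos hl0 (q - 1)
    exact neg_ne_zero.2 (by positivity)
  have hmono : 𝓝[<] (1 : ℝ) ≤ 𝓝[≠] 1 := nhdsWithin_mono _ fun z hz => ne_of_lt hz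
  have h := ((hasDerivAt_iff_tendsto_slope.1 h1).div (hasDerivAt_iff_tendsto_slope.1 h2)
    hne).mono_left hmono
  rw [neg_div_neg_eq] at h
  refine h.congr' ?_
  filter_upwards [self_mem_nhdsWithin] with z hz
  have hz' : z - 1 ≠ 0 := sub_ne_zero.2 (ne_of_lt hz)
  have hd : ratioDenom l q 1 = 0 := by simp [ratioDenom]
  simp only [Pi.div_apply, slope_def_field, Real.one_rpow, sub_self, sub_zero, hd]
  rw [div_div_div_cancel_right₀ hz']

theorem tendsto_one_sub_rpow {p : ℝ} (hp : 0 < p) :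
    Filter.Tendsto (fun z : ℝ => 1 - z ^ p) (𝓝[<] 1) (𝓝[>] 0) := by
  refine tendsto_nhdsWithin_iff.2 ⟨?_, ?_⟩
  · have : ContinuousAt (fun z : ℝ => 1 - z ^ p) 1 :=
      continuousAt_const.sub (Real.continuousAt_rpow_const 1 p (Or.inl one_ne_zero))
    simpa using this.tendsto.mono_left nhdsWithin_le_nhds
  · filter_upwards [Ioo_mem_nhdsLT (show (0 : ℝ) < 1 by norm_num)] with z hz
    have := Real.rpow_lt_one hz.1.le hz.2 hp
    exact sub_pos.2 this

/-- The last factor has a positive finite limit at `1` when `l, p, q > 0`, so the sign of `q / p -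
1` alone decides the behaviour there. -/
theorem ratioPow_eq_mul {l p q z : ℝ} (hp : 0 < p) (hz0 : 0 ≤ z) (hz1 : z < 1) :
    ratioPow l p q z = (1 - z ^ p) ^ (q / p - 1) * ((1 - z ^ p) / ratioDenom l q z) := by
  have h : 0 < 1 - z ^ p := sub_pos.2 (Real.rpow_lt_one hz0 hz1 hp)
  rw [ratioPow, ← mul_div_assoc, ← Real.rpow_add_one h.ne', sub_add_cancel]

theorem ratioPow_eventuallyEq {l p q : ℝ} (hp : 0 < p) :
    ratioPow l p q =ᶠ[𝓝[<] 1]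
      fun z => (1 - z ^ p) ^ (q / p - 1) * ((1 - z ^ p) / ratioDenom l q z) := by
  filter_upwards [Ioo_mem_nhdsLT (show (0 : ℝ) < 1 by norm_num)] with z hz
  exact ratioPow_eq_mul hp hz.1.le hz.2

theorem tendsto_ratioPow_self {l p : ℝ} (hl0 : 0 < l) (hp : 0 < p) :
    Filter.Tendsto (ratioPow l p p) (𝓝[<] 1) (𝓝 (l ^ (1 - p))) := by
  have h := tendsto_one_sub_rpow_div_ratioDenom p hl0 hp
  have e : p / (p * l ^ (p - 1)) = l ^ (1 - p) := by
    rw [div_mul_cancel_left₀ hp.ne', ← Real.rpow_neg hl0.le, neg_sub]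
  rw [e] at h
  refine h.congr' ?_
  filter_upwards [ratioPow_eventuallyEq (l := l) (q := p) hp] with z hz
  rw [hz, div_self hp.ne', sub_self, Real.rpow_zero, one_mul]

theorem tendsto_ratioPow_zero {l p q : ℝ} (hl0 : 0 < l) (hp : 0 < p) (hpq : p < q) :
    Filter.Tendsto (ratioPow l p q) (𝓝[<] 1) (𝓝 0) := by
  have he : 0 < q / p - 1 := sub_pos.2 ((one_lt_div hp).2 hpq)
  have h1 : Filter.Tendsto (fun z : ℝ => (1 - z ^ p) ^ (q / p - 1)) (𝓝[<] 1) (𝓝 0) := by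
    have := ((Real.continuousAt_rpow_const 0 (q / p - 1) (Or.inr he.le)).tendsto).comp
      ((tendsto_one_sub_rpow hp).mono_right nhdsWithin_le_nhds)
    rwa [Real.zero_rpow he.ne'] at this
  have h := h1.mul (tendsto_one_sub_rpow_div_ratioDenom p hl0 (hp.trans hpq))
  rw [zero_mul] at h
  exact h.congr' (ratioPow_eventuallyEq hp).symm

theorem tendsto_ratioPow_atTop {l p q : ℝ} (hl0 : 0 < l) (hq : 0 < q) (hpq : q < p) :
    Filter.Tendsto (ratioPow l p q) (𝓝[<] 1) Filter.atTop := by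
  have hp : 0 < p := hq.trans hpq
  have he : q / p - 1 < 0 := sub_neg.2 ((div_lt_one hp).2 hpq)
  have h1 : Filter.Tendsto (fun z : ℝ => (1 - z ^ p) ^ (q / p - 1)) (𝓝[<] 1) Filter.atTop :=
    (tendsto_rpow_neg_nhdsGT_zero he).comp (tendsto_one_sub_rpow hp)
  have hpos : 0 < p / (q * l ^ (q - 1)) := by
    have := Real.rpow_pos_of_pos hl0 (q - 1)
    positivity
  exact (h1.atTop_mul_pos hpos (tendsto_one_sub_rpow_div_ratioDenom p hl0 hq)).congr'
    (ratioPow_eventuallyEq hp).symm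

/-- At `z = 0` numerator and denominator both equal `1`. Since `p, q > 1`, the numerator has slope
`0` there and the denominator slope `-(1 - l) * q < 0`. -/
theorem exists_one_lt_ratioPow {l p q : ℝ} (hl0 : 0 < l) (hl1 : l < 1) (hp : 1 < p)
    (hq : 1 < q) : ∃ z : ℝ, 0 < z ∧ z < 1 ∧ 1 < ratioPow l p q z := by
  have h0 : HasDerivAt (fun z : ℝ => z ^ p) 0 0 := by
    simpa [Real.zero_rpow (show p - 1 ≠ 0 by linarith)] using
      Real.hasDerivAt_rpow_const (x := 0) (p := p) (Or.inr hp.le)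
  have h1 : HasDerivAt (fun z : ℝ => (1 - z ^ p) ^ (q / p)) 0 0 := by
    have := (h0.const_sub 1).rpow_const (p := q / p)
      (Or.inl (by simp [Real.zero_rpow (show p ≠ 0 by linarith)]))
    simpa using this
  have h2 : HasDerivAt (fun z : ℝ => (1 - (1 - l) * z) ^ q) (-((1 - l) * q)) 0 := by
    have := (((hasDerivAt_id (0 : ℝ)).const_mul (1 - l)).const_sub 1).rpow_const (p := q)
      (Or.inl (by simp))
    refine this.congr_deriv ?_
    simp
    ring
  have h3 : HasDerivAt (fun z : ℝ => (l * z) ^ q) 0 0 := by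
    have := ((hasDerivAt_id (0 : ℝ)).const_mul l).rpow_const (p := q) (Or.inr hq.le)
    simpa [Real.zero_rpow (show q - 1 ≠ 0 by linarith)] using this
  have hd : HasDerivAt (fun z : ℝ => (1 - z ^ p) ^ (q / p) - ratioDenom l q z)
      ((1 - l) * q) 0 := by
    refine (h1.sub (h2.sub h3)).congr_deriv ?_
    ring
  have hpos : 0 < (1 - l) * q := mul_pos (by linarith) (by linarith)
  have hs := (hasDerivAt_iff_tendsto_slope.1 hd).mono_left
    (nhdsWithin_mono 0 fun z (hz : z ∈ Set.Ioi 0) => ne_of_gt hz)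
  obtain ⟨z, hz, hz0, hz1⟩ := ((hs.eventually_const_lt hpos).and
    (Ioo_mem_nhdsGT (show (0 : ℝ) < 1 by norm_num))).exists
  refine ⟨z, hz0, hz1, ?_⟩
  rw [slope_def_field, sub_zero, Real.zero_rpow (by linarith : p ≠ 0)] at hz
  have e : ratioDenom l q 0 = 1 := by simp [ratioDenom, Real.zero_rpow (by linarith : q ≠ 0)]
  rw [e, sub_zero, Real.one_rpow, sub_self, sub_zero, lt_div_iff₀ hz0, zero_mul] at hz
  rw [ratioPow, one_lt_div (ratioDenom_pos hl0 hl1 hq.le hz0.le hz1)]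
  linarith

theorem exists_isMaxOn_ratioPow {l p q : ℝ} (hl0 : 0 < l) (hl1 : l < 1) (hp : 1 < p)
    (hpq : p < q) : ∃ z : ℝ, 0 < z ∧ z < 1 ∧ 1 < ratioPow l p q z ∧
      ∀ y : ℝ, 0 ≤ y → y < 1 → ratioPow l p q y ≤ ratioPow l p q z := by
  have hp0 : 0 < p := by linarith
  have hq : 1 < q := hp.trans hpq
  have h1 : ratioPow l p q 1 = 0 := by simp [ratioPow, ratioDenom]
  have hc : ContinuousOn (ratioPow l p q) (Set.Icc 0 1) := by
    intro z hz
    -- At `1` the quotient is `0 / 0`, whose default value `0` agrees with the limit because `p <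
    -- q`.
    rcases hz.2.eq_or_lt with rfl | hz1
    · rw [← Set.Ico_insert_right zero_le_one, continuousWithinAt_insert_self,
        ContinuousWithinAt, h1]
      exact (tendsto_ratioPow_zero hl0 hp0 hpq).mono_left
        (nhdsWithin_mono _ Set.Ico_subset_Iio_self)
    · have hd : ContinuousAt (ratioDenom l q) z := by
        unfold ratioDenom
        have : 0 ≤ q := by linarith
        fun_prop (disch := first | assumption | exact Or.inr this)
      have hn : ContinuousAt (fun z : ℝ => (1 - z ^ p) ^ (q / p)) z :=
        ((continuousAt_const.sub (Real.continuousAt_rpow_const z p (Or.inr hp0.le))).rpow_const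
          (Or.inr (by positivity)))
      exact (hn.div hd (ratioDenom_pos hl0 hl1 hq.le hz.1 hz1).ne').continuousWithinAt
  obtain ⟨z, hz, hmax⟩ := isCompact_Icc.exists_isMaxOn ⟨0, by simp⟩ hc
  obtain ⟨w, hw0, hw1, hw⟩ := exists_one_lt_ratioPow hl0 hl1 hp hq
  have hz1 : 1 < ratioPow l p q z := hw.trans_le (hmax ⟨hw0.le, hw1.le⟩)
  refine ⟨z, hz.1.lt_of_ne ?_, hz.2.lt_of_ne ?_, hz1, fun y hy0 hy1 => hmax ⟨hy0, hy1.le⟩⟩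
  · rintro rfl
    simp [ratioPow, ratioDenom, hp0.ne', (by linarith : q ≠ 0)] at hz1
  · rintro rfl
    rw [h1] at hz1
    linarith

theorem scalar_bound_of_ratioPow_le {l p q K : ℝ} (hl0 : 0 < l) (hl1 : l < 1) (hp : 0 < p)
    (hq : 1 ≤ q) (hK : 0 ≤ K) (h : ∀ y : ℝ, 0 ≤ y → y < 1 → ratioPow l p q y ≤ K)
    (z : ℝ) (hz0 : 0 ≤ z) (hz1 : z ≤ 1) :
    (1 - z ^ p) ^ (q / p) + (l * K ^ (1 / q) * z) ^ q
      ≤ (K ^ (1 / q) * (1 - (1 - l) * z)) ^ q := by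
  have hq0 : 0 < q := by linarith
  have hy : 0 ≤ 1 - (1 - l) * z := by nlinarith
  have hC : 0 ≤ K ^ (1 / q) := by positivity
  have hCq : (K ^ (1 / q)) ^ q = K := by rw [one_div, Real.rpow_inv_rpow hK hq0.ne']
  rw [mul_comm l, mul_assoc, Real.mul_rpow hC (by positivity), Real.mul_rpow hC hy, hCq]
  -- At `z = 1` the denominator vanishes and both sides equal `K * l ^ q`.
  rcases hz1.eq_or_lt with rfl | hz1
  · simp [(div_pos hq0 hp).ne']
  · have := h z hz0 hz1
    rw [ratioPow, div_le_iff₀ (ratioDenom_pos hl0 hl1 hq hz0 hz1), ratioDenom] at this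
    linarith

theorem ratioPow_self_le {l p z : ℝ} (hl0 : 0 < l) (hl1 : l < 1) (hp : 1 ≤ p)
    (hz0 : 0 ≤ z) (hz1 : z < 1) : ratioPow l p p z ≤ l ^ (1 - p) := by
  have h := ratioDenom_lower hl0 hl1 hp hz0 hz1.le
  rw [ratioPow, div_self (by linarith), Real.rpow_one,
    div_le_iff₀ (ratioDenom_pos hl0 hl1 hp hz0 hz1)]
  have hl : 0 < l ^ (1 - p) := Real.rpow_pos_of_pos hl0 _
  calc 1 - z ^ p = l ^ (1 - p) * (l ^ (p - 1) * (1 - z ^ p)) := by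
        rw [← mul_assoc, ← Real.rpow_add hl0, show 1 - p + (p - 1) = 0 by ring, Real.rpow_zero,
          one_mul]
    _ ≤ _ := mul_le_mul_of_nonneg_left h hl.le

/-! ### Thinning of geometric distributions -/

/-- The negative binomial series at `(1 - l) * z`, after dropping the vanishing terms `k < n`. -/
theorem thinning_geom {l z : ℝ} (hl0 : 0 < l) (hl1 : l < 1) (hz0 : 0 < z) (hz1 : z < 1) :
    thinning l (geom z) = geom (l * z / (1 - (1 - l) * z)) := by
  funext n
  have hy : 0 < 1 - (1 - l) * z := by nlinarith
  have hr0 : 0 ≤ (1 - l) * z := by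
    have : 0 < 1 - l := by linarith
    positivity
  have hs := hasSum_choose_mul_geometric_of_norm_lt_one n (r := (1 - l) * z)
    (by rw [Real.norm_of_nonneg hr0]; linarith)
  have hs' : HasSum (fun k => transition l n k * ((1 - z) * z ^ k))
      ((1 - z) * (l * z) ^ n * (1 / (1 - (1 - l) * z) ^ (n + 1))) := by
    rw [← hasSum_nat_add_iff' n, Finset.sum_eq_zero, sub_zero]
    · refine (hs.mul_left ((1 - z) * (l * z) ^ n)).congr_fun fun k => ?_
      simp only [transition, Nat.add_sub_cancel, mul_pow]
      ring
    · intro k hk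
      simp [transition, Nat.choose_eq_zero_of_lt (Finset.mem_range.1 hk)]
  have hc := (Complex.hasSum_ofReal.2 hs').tsum_eq
  simp only [thinning, geom]
  convert hc using 2
  · push_cast
    rfl
  · rw [show 1 - l * z / (1 - (1 - l) * z) = (1 - z) / (1 - (1 - l) * z) by
      rw [eq_div_iff hy.ne', sub_mul, div_mul_cancel₀ _ hy.ne']; ring]
    rw [div_pow, pow_succ]
    field_simp

theorem seqNorm_geom {p z : ℝ} (hp : 0 < p) (hz0 : 0 ≤ z) (hz1 : z < 1) :
    seqNorm p (geom z) = ENNReal.ofReal ((1 - z) / (1 - z ^ p) ^ (1 / p)) := by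
  have hz : 0 ≤ 1 - z := by linarith
  have hzp : z ^ p < 1 := Real.rpow_lt_one hz0 hz1 hp
  have hzp0 : 0 ≤ z ^ p := Real.rpow_nonneg hz0 p
  have ht : ∀ n, ‖geom z n‖ₑ ^ p = ENNReal.ofReal ((1 - z) ^ p * (z ^ p) ^ n) := fun n => by
    rw [geom, ← ofReal_norm, Complex.norm_real, Real.norm_of_nonneg (by positivity),
      ENNReal.ofReal_rpow_of_nonneg (by positivity) hp.le, Real.mul_rpow hz (by positivity),
      ← Real.rpow_natCast, ← Real.rpow_natCast, ← Real.rpow_mul hz0, ← Real.rpow_mul hz0,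
      mul_comm p]
  have hs := (hasSum_geometric_of_lt_one hzp0 hzp).mul_left ((1 - z) ^ p)
  rw [seqNorm, tsum_congr ht, ← ENNReal.ofReal_tsum_of_nonneg (fun n => by positivity)
    hs.summable, hs.tsum_eq, ENNReal.ofReal_rpow_of_nonneg
    (mul_nonneg (by positivity) (inv_nonneg.2 (by linarith))) (by positivity),
    Real.mul_rpow (by positivity) (inv_nonneg.2 (by linarith)),
    Real.inv_rpow (by linarith), one_div, Real.rpow_rpow_inv hz hp.ne', div_eq_mul_inv]

theorem seqNorm_thinning_geom_div {l p q z : ℝ} (hl0 : 0 < l) (hl1 : l < 1) (hp : 0 < p)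
    (hq : 1 ≤ q) (hz0 : 0 < z) (hz1 : z < 1) :
    seqNorm q (thinning l (geom z)) / seqNorm p (geom z)
      = ENNReal.ofReal (ratioPow l p q z ^ (1 / q)) := by
  have hq0 : 0 < q := by linarith
  have hy : 0 < 1 - (1 - l) * z := by nlinarith
  have hw0 : 0 ≤ l * z / (1 - (1 - l) * z) := by positivity
  have hw1 : l * z / (1 - (1 - l) * z) < 1 := by rw [div_lt_one hy]; linarith
  have hzp : 0 < 1 - z ^ p := sub_pos.2 (Real.rpow_lt_one hz0.le hz1 hp)
  have hz : 0 < 1 - z := by linarith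
  have hd := ratioDenom_pos hl0 hl1 hq hz0.le hz1
  rw [thinning_geom hl0 hl1 hz0 hz1, seqNorm_geom hq0 hw0 hw1, seqNorm_geom hp hz0.le hz1,
    ← ENNReal.ofReal_div_of_pos (by positivity)]
  congr 1
  have e1 : 1 - l * z / (1 - (1 - l) * z) = (1 - z) / (1 - (1 - l) * z) := by
    rw [eq_div_iff hy.ne', sub_mul, div_mul_cancel₀ _ hy.ne']
    ring
  have e2 : 1 - (l * z / (1 - (1 - l) * z)) ^ q = ratioDenom l q z / (1 - (1 - l) * z) ^ q := by
    rw [Real.div_rpow (by positivity) hy.le, ratioDenom, sub_div,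
      div_self (Real.rpow_pos_of_pos hy q).ne']
  rw [e1, e2, ratioPow, Real.div_rpow hd.le (by positivity),
    Real.div_rpow (by positivity) hd.le, ← Real.rpow_mul hzp.le, ← Real.rpow_mul hy.le,
    mul_one_div_cancel hq0.ne', Real.rpow_one, show q / p * (1 / q) = 1 / p by field_simp]
  have := Real.rpow_pos_of_pos hd (1 / q)
  generalize 1 - (1 - l) * z = y at hy ⊢
  field_simp

theorem seqNorm_geom_pos {p z : ℝ} (hp : 0 < p) (hz0 : 0 ≤ z) (hz1 : z < 1) :
    0 < seqNorm p (geom z) := by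
  have hzp : 0 < 1 - z ^ p := sub_pos.2 (Real.rpow_lt_one hz0 hz1 hp)
  have hz : 0 < 1 - z := by linarith
  rw [seqNorm_geom hp hz0 hz1, ENNReal.ofReal_pos]
  positivity

theorem seqNorm_geom_lt_top {p z : ℝ} (hp : 0 < p) (hz0 : 0 ≤ z) (hz1 : z < 1) :
    seqNorm p (geom z) < ∞ := by
  rw [seqNorm_geom hp hz0 hz1]
  exact ENNReal.ofReal_lt_top

/-! ### Two-sided bounds for the operator norm -/

theorem ofReal_ratioPow_le_opNorm {l p q z : ℝ} (hl0 : 0 < l) (hl1 : l < 1) (hp : 0 < p)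
    (hq : 1 ≤ q) (hz0 : 0 < z) (hz1 : z < 1) :
    ENNReal.ofReal (ratioPow l p q z ^ (1 / q)) ≤ opNorm p q (thinning l) := by
  rw [← seqNorm_thinning_geom_div hl0 hl1 hp hq hz0 hz1]
  exact le_iSup_of_le (geom z) (le_iSup_of_le (seqNorm_geom_pos hp hz0.le hz1)
    (le_iSup_of_le (seqNorm_geom_lt_top hp hz0.le hz1) le_rfl))

theorem eventually_seqNorm_thinning_geom_div {l p q : ℝ} (hl0 : 0 < l) (hl1 : l < 1)
    (hp : 0 < p) (hq : 1 ≤ q) :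
    (fun z : ℝ => ENNReal.ofReal (ratioPow l p q z ^ (1 / q))) =ᶠ[𝓝[<] 1]
      fun z => seqNorm q (thinning l (geom z)) / seqNorm p (geom z) := by
  filter_upwards [Ioo_mem_nhdsLT (show (0 : ℝ) < 1 by norm_num)] with z hz
  exact (seqNorm_thinning_geom_div hl0 hl1 hp hq hz.1 hz.2).symm

theorem le_opNorm_of_tendsto {l p q : ℝ} (hl0 : 0 < l) (hl1 : l < 1) (hp : 0 < p) (hq : 1 ≤ q)
    {a : ℝ≥0∞} (h : Filter.Tendsto
      (fun z : ℝ => seqNorm q (thinning l (geom z)) / seqNorm p (geom z)) (𝓝[<] 1) (𝓝 a)) :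
    a ≤ opNorm p q (thinning l) := by
  refine le_of_tendsto h ?_
  filter_upwards [Ioo_mem_nhdsLT (show (0 : ℝ) < 1 by norm_num)] with z hz
  rw [seqNorm_thinning_geom_div hl0 hl1 hp hq hz.1 hz.2]
  exact ofReal_ratioPow_le_opNorm hl0 hl1 hp hq hz.1 hz.2

theorem seqNorm_thinning_div_le {l p q K : ℝ} (hl0 : 0 < l) (hl1 : l < 1) (hp : 0 < p)
    (hq : 1 ≤ q) (hK : 0 ≤ K) (h : ∀ y : ℝ, 0 ≤ y → y < 1 → ratioPow l p q y ≤ K)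
    {x : ℕ → ℂ} (hx : seqNorm p x < ∞) :
    seqNorm q (thinning l x) / seqNorm p x ≤ ENNReal.ofReal (K ^ (1 / q)) :=
  ENNReal.div_le_of_le_mul (seqNorm_thinning_le hl0 hl1 hp hq (by positivity)
    (scalar_bound_of_ratioPow_le hl0 hl1 hp hq hK h) hx)

theorem opNorm_thinning_le {l p q K : ℝ} (hl0 : 0 < l) (hl1 : l < 1) (hp : 0 < p)
    (hq : 1 ≤ q) (hK : 0 ≤ K) (h : ∀ y : ℝ, 0 ≤ y → y < 1 → ratioPow l p q y ≤ K) :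
    opNorm p q (thinning l) ≤ ENNReal.ofReal (K ^ (1 / q)) :=
  iSup_le fun _ => iSup_le fun _ => iSup_le fun hx =>
    seqNorm_thinning_div_le hl0 hl1 hp hq hK h hx

end Thinning

theorem theorem8p2 (l : ℝ) (hl0 : 0 < l) (hl1 : l < 1) :
    (∀ p q : ℝ, 1 < p → p < q →
      ∃ z : ℝ, 0 < z ∧ z < 1 ∧
        (∀ x : ℕ → ℂ, x ≠ 0 → Thinning.seqNorm p x < ∞ →
          Thinning.seqNorm q (Thinning.thinning l x) / Thinning.seqNorm p x ≤
            Thinning.seqNorm q (Thinning.thinning l (Thinning.geom z)) /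
              Thinning.seqNorm p (Thinning.geom z)) ∧
        Thinning.seqNorm q (Thinning.thinning l (Thinning.geom z)) /
            Thinning.seqNorm p (Thinning.geom z) =
          Thinning.opNorm p q (Thinning.thinning l) ∧
        Thinning.opNorm p q (Thinning.thinning l) < ∞) ∧
    (∀ p : ℝ, 1 < p →
      (∀ x : ℕ → ℂ, x ≠ 0 → Thinning.seqNorm p x < ∞ →
        Thinning.seqNorm p (Thinning.thinning l x) / Thinning.seqNorm p x ≤
          ENNReal.ofReal (l ^ ((1 - p) / p))) ∧
      Filter.Tendsto
        (fun z : ℝ => Thinning.seqNorm p (Thinning.thinning l (Thinning.geom z)) /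
          Thinning.seqNorm p (Thinning.geom z))
        (𝓝[<] 1) (𝓝 (ENNReal.ofReal (l ^ ((1 - p) / p)))) ∧
      Thinning.opNorm p p (Thinning.thinning l) = ENNReal.ofReal (l ^ ((1 - p) / p))) ∧
    (∀ p q : ℝ, 1 < q → q < p →
      Filter.Tendsto
        (fun z : ℝ => Thinning.seqNorm q (Thinning.thinning l (Thinning.geom z)) /
          Thinning.seqNorm p (Thinning.geom z))
        (𝓝[<] 1) (𝓝 ∞) ∧
      Thinning.opNorm p q (Thinning.thinning l) = ∞) := by
  refine ⟨fun p q hp hpq => ?_, fun p hp => ?_, fun p q hq hpq => ?_⟩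
  · have hp0 : 0 < p := by linarith
    have hq : 1 ≤ q := by linarith
    obtain ⟨z, hz0, hz1, hz, hmax⟩ := Thinning.exists_isMaxOn_ratioPow hl0 hl1 hp hpq
    have hK : 0 ≤ Thinning.ratioPow l p q z := by linarith
    have hle := Thinning.opNorm_thinning_le hl0 hl1 hp0 hq hK hmax
    refine ⟨z, hz0, hz1, ?_⟩
    rw [Thinning.seqNorm_thinning_geom_div hl0 hl1 hp0 hq hz0 hz1]
    exact ⟨fun x _ hx => Thinning.seqNorm_thinning_div_le hl0 hl1 hp0 hq hK hmax hx,
      le_antisymm (Thinning.ofReal_ratioPow_le_opNorm hl0 hl1 hp0 hq hz0 hz1) hle,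
      hle.trans_lt ENNReal.ofReal_lt_top⟩
  · have hp0 : 0 < p := by linarith
    have hK : 0 ≤ l ^ (1 - p) := Real.rpow_nonneg hl0.le _
    have hmax := fun y hy0 hy1 => Thinning.ratioPow_self_le (z := y) hl0 hl1 hp.le hy0 hy1
    have e : (l ^ (1 - p)) ^ (1 / p) = l ^ ((1 - p) / p) := by
      rw [← Real.rpow_mul hl0.le, mul_one_div]
    have hlim := ((ENNReal.continuous_ofReal.tendsto _).comp
      ((Thinning.tendsto_ratioPow_self hl0 hp0).rpow_const (p := 1 / p)
        (Or.inr (by positivity)))).congr'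
      (Thinning.eventually_seqNorm_thinning_geom_div hl0 hl1 hp0 hp.le)
    have hle := Thinning.opNorm_thinning_le hl0 hl1 hp0 hp.le hK hmax
    rw [e] at hlim hle
    refine ⟨fun x _ hx => ?_, hlim,
      le_antisymm hle (Thinning.le_opNorm_of_tendsto hl0 hl1 hp0 hp.le hlim)⟩
    rw [← e]
    exact Thinning.seqNorm_thinning_div_le hl0 hl1 hp0 hp.le hK hmax hx
  · have hq0 : 0 < q := by linarith
    have hp0 : 0 < p := by linarith
    have hlim := (ENNReal.tendsto_ofReal_atTop.comp
      ((tendsto_rpow_atTop (one_div_pos.2 hq0)).comp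
        (Thinning.tendsto_ratioPow_atTop hl0 hq0 hpq))).congr'
      (Thinning.eventually_seqNorm_thinning_geom_div hl0 hl1 hp0 hq.le)
    exact ⟨hlim, top_le_iff.1 (Thinning.le_opNorm_of_tendsto hl0 hl1 hp0 hq.le hlim)⟩
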